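/- Let $V$ be a finite set and let $G$ be a graph with node set $V$ whose edges are solid directed ($\rightarrow$), dashed directed ($\dashrightarrow$) or undirected ($-$), with at most one edge between any two nodes and no loops. Write $a\multimap b$ if $a\rightarrow b$, $a\dashrightarrow b$ or $a-b$ is in $G$. For $X\subseteq V$ let $$Fa(X)=\{b: b\rightarrow a \text{ in } G \text{ for some } a\in X\},\quad Mo(X)=\{b: b\dashrightarrow a \text{ in } G\text{ for some } a\in X\},$$ $$Pa(X)=Fa(X)\cup Mo(X),\qquad Ne(X)=\{b: b-a\text{ in } G\text{ for some } a\in X\},$$ and let $Nd(X)$ be the set of nodes $b$ such that no route $a\multimap\cdots\multimap b$ with $a\in X$ contains a directed (solid or dashed) edge; write $Fa(i)=Fa(\{i\})$, etc. A chain component of $G$ is a maximal non-empty set of nodes any two of which are joined by a route of undirected edges; $Cc(G)$ is the set of chain components. Assume that $G$ is a unified chain graph (UCG): $G$ has no semidirected cycle (a closed route $v_1\multimap v_2\multimap\cdots\multimap v_n=v_1$, $n\ge 2$, whose first edge is directed), and $Fa(K)\cap Mo(K)=\emptyset$ for all $K\in Cc(G)$. Let $p$ be a Gaussian distribution on $\mathbb{R}^V$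 with positive definite covariance matrix $\Sigma$. For $K\in Cc(G)$ let $$\beta_K=\Sigma_{K,Pa(K)}\Sigma_{Pa(K),Pa(K)}^{-1},\qquad \Lambda_K=\Sigma_{K,K}-\Sigma_{K,Pa(K)}\Sigma_{Pa(K),Pa(K)}^{-1}\Sigma_{Pa(K),K},$$ and let $\Omega^{K}=(\Sigma_{K\cup Pa(K),K\cup Pa(K)})^{-1}$ be the precision matrix of the marginal $p(K,Pa(K))$. Theorem. The following are equivalent. (a) $p$ factorizes as $p(V)=\prod_{K\in Cc(G)}p(K\mid Pa(K))$ (an almost-everywhere equality of Lebesgue densities, where $p(K\mid Pa(K))$ is the quotient of the marginal densities of $K\cup Pa(K)$ and $Pa(K)$), and for all $K\in Cc(G)$ and $i\in K$: $(\beta_K)_{i,j}=0$ for all $j\in Mo(K)\setminus Mo(i)$; $\Omega^{K}_{i,j}=0$ for all $j\in Fa(K)\setminus Fa(i)$; $(\Lambda_K^{-1})_{i,j}=0$ for all $j\in K\setminus(\{i\}\cup Ne(i))$. (b) $p$ satisfies the block-recursive Markov property with respect to $G$: for all $K\in Cc(G)$ and $i\in K$, the following conditional independences hold in $p$: (B1)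 $i\perp Nd(K)\setminus (K\cup Fa(K)\cup Mo(i))\mid Fa(K)\cup Mo(i)$; (B2) $i\perp Nd(K)\setminus (K\cup Fa(i)\cup Mo(K))\mid (K\setminus\{i\})\cup Fa(i)\cup Mo(K)$; (B3) $i\perp j\mid (K\setminus\{i,j\})\cup Pa(K)$ for all $j\in K\setminus(\{i\}\cup Ne(i))$. -/

import Mathlib

open MeasureTheory ProbabilityTheory

/-- A graph over `V` with solid directed edges, dashed directed edges and undirected edges, and with
at most one edge between any pair of nodes (and no loops). -/
structure MixedGraph (V : Type*) where
  /-- `solid a b` is the edge `a → b`. -/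
  solid : V → V → Prop
  /-- `dashed a b` is the dashed edge from `a` to `b`. -/
  dashed : V → V → Prop
  /-- `und.Adj a b` is the edge `a - b`. -/
  und : SimpleGraph V
  solid_asymm : ∀ a b, solid a b → ¬ solid b a
  dashed_asymm : ∀ a b, dashed a b → ¬ dashed b a
  not_dashed_of_solid : ∀ a b, solid a b → ¬ dashed a b ∧ ¬ dashed b a
  not_und_of_solid : ∀ a b, solid a b → ¬ und.Adj a b
  not_und_of_dashed : ∀ a b, dashed a b → ¬ und.Adj a b

namespace MixedGraph

variable {V : Type*}

/-- There is a directed edge (solid or dashed) from `a` to `b`. -/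
def Directed (G : MixedGraph V) (a b : V) : Prop := G.solid a b ∨ G.dashed a b

/-- `a ⊸ b`: there is a solid or a dashed edge from `a` to `b`, or an undirected edge. -/
def Step (G : MixedGraph V) (a b : V) : Prop := G.Directed a b ∨ G.und.Adj a b

/-- No semidirected cycle, i.e. no directed edge from `a` to `b` that is continued by
`b ⊸ ⋯ ⊸ a`. -/
def IsChainGraph (G : MixedGraph V) : Prop :=
  ∀ a b, G.Directed a b → ¬ Relation.ReflTransGen G.Step b a

section Finite

variable [Fintype V]

open Classical in
/-- The fathers of `X`: the tails of the solid directed edges into `X`. -/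
noncomputable def fa (G : MixedGraph V) (X : Finset V) : Finset V :=
  Finset.univ.filter fun b => ∃ a ∈ X, G.solid b a

open Classical in
/-- The mothers of `X`: the tails of the dashed directed edges into `X`. -/
noncomputable def mo (G : MixedGraph V) (X : Finset V) : Finset V :=
  Finset.univ.filter fun b => ∃ a ∈ X, G.dashed b a

open Classical in
/-- The parents of `X`: the tails of the directed edges into `X`. -/
noncomputable def pa (G : MixedGraph V) (X : Finset V) : Finset V :=
  Finset.univ.filter fun b => ∃ a ∈ X, G.Directed b a

open Classical in
/-- The neighbors of `X`. -/
noncomputable def ne (G : MixedGraph V) (X : Finset V) : Finset V :=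
  Finset.univ.filter fun b => ∃ a ∈ X, G.und.Adj b a

open Classical in
/-- The non-descendants of `X`: the nodes `b` such that no route `a ⊸ ⋯ ⊸ b` with `a ∈ X` contains
a directed edge. -/
noncomputable def nd (G : MixedGraph V) (X : Finset V) : Finset V :=
  Finset.univ.filter fun b => ¬ ∃ a ∈ X, ∃ c d, Relation.ReflTransGen G.Step a c ∧
    G.Directed c d ∧ Relation.ReflTransGen G.Step d b

/-- A chain component: a maximal (non-empty) set of nodes any two of which are joined by an
undirected route. -/
def IsChainComponent (G : MixedGraph V) (K : Finset V) : Prop :=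
  Maximal (fun S : Finset V => S.Nonempty ∧ ∀ a ∈ S, ∀ b ∈ S, G.und.Reachable a b) K

open Classical in
/-- The set of chain components. -/
noncomputable def chainComponents (G : MixedGraph V) : Finset (Finset V) :=
  Finset.univ.filter fun K => G.IsChainComponent K

/-- A unified chain graph: a chain graph no chain component of which has a node that is both a
father and a mother of it. -/
structure IsUCG (G : MixedGraph V) : Prop where
  isChainGraph : G.IsChainGraph
  disjoint_fa_mo : ∀ K, G.IsChainComponent K → Disjoint (G.fa K) (G.mo K)

end Finite

end MixedGraph

section Distribution

variable {V : Type*} [Fintype V]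

/-- `A` and `B` are conditionally independent given `C` in the distribution `P` of the random
variables indexed by `V` (the coordinate functions on `V → ℝ`). -/
def CondIndepGiven (P : Measure (V → ℝ)) [IsFiniteMeasure P] (A B C : Finset V) : Prop :=
  CondIndepFun (MeasurableSpace.comap (C.restrict (π := fun _ => ℝ)) inferInstance)
    (Finset.measurable_restrict C).comap_le
    (A.restrict (π := fun _ => ℝ)) (B.restrict (π := fun _ => ℝ)) P

/-- The covariance matrix of `P`. -/
noncomputable def covMat (P : Measure (V → ℝ)) : Matrix V V ℝ :=
  Matrix.of fun i j => cov[fun x => x i, fun x => x j; P]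

/-- The block of the covariance matrix with rows `A` and columns `B`. -/
noncomputable def covBlock (P : Measure (V → ℝ)) (A B : Finset V) : Matrix A B ℝ :=
  (covMat P).submatrix (fun i : A => (i : V)) (fun j : B => (j : V))

/-- The Lebesgue density of the marginal distribution of the variables in `A`, at the subvector
`x_A` of `x`. -/
noncomputable def margDensity (P : Measure (V → ℝ)) (A : Finset V) (x : V → ℝ) : ENNReal :=
  (P.map (A.restrict (π := fun _ => ℝ))).rnDeriv volume (A.restrict x)

variable [DecidableEq V]

/-- The conditional density `p(K | A)`, at the subvectors `x_K`, `x_A` of `x`. -/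
noncomputable def condDensity (P : Measure (V → ℝ)) (K A : Finset V) (x : V → ℝ) : ENNReal :=
  margDensity P (K ∪ A) x / margDensity P A x

/-- The matrix of the coefficients of the regression of `K` on `A`. -/
noncomputable def regCoef (P : Measure (V → ℝ)) (K A : Finset V) : Matrix K A ℝ :=
  covBlock P K A * (covBlock P A A)⁻¹

/-- The conditional covariance matrix of `K` given `A`. -/
noncomputable def condCov (P : Measure (V → ℝ)) (K A : Finset V) : Matrix K K ℝ :=
  covBlock P K K - covBlock P K A * (covBlock P A A)⁻¹ * covBlock P A K

/-- The precision matrix of the marginal distribution of the variables in `A`. -/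
noncomputable def precMat (P : Measure (V → ℝ)) (A : Finset V) : Matrix A A ℝ :=
  (covBlock P A A)⁻¹

/-- `p(V) = ∏ p(K | Pa(K))`, the product over the chain components `K`, as densities with respect
to Lebesgue measure. -/
def Factorizes (G : MixedGraph V) (P : Measure (V → ℝ)) : Prop :=
  ∀ᵐ x ∂(volume : Measure (V → ℝ)),
    P.rnDeriv volume x = ∏ K ∈ G.chainComponents, condDensity P K (G.pa K) x

/-- The zero restrictions on the regression coefficients, the precision matrix and the inverse
conditional covariance matrix that are associated with the missing edges of `G`. -/
structure ZeroRestrictions (G : MixedGraph V) (P : Measure (V → ℝ)) : Prop where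
  mothers : ∀ K, G.IsChainComponent K → ∀ (i : K) (j : G.pa K),
    (j : V) ∈ G.mo K \ G.mo {(i : V)} → regCoef P K (G.pa K) i j = 0
  fathers : ∀ K, G.IsChainComponent K → ∀ i j : (K ∪ G.pa K : Finset V),
    (i : V) ∈ K → (j : V) ∈ G.fa K \ G.fa {(i : V)} → precMat P (K ∪ G.pa K) i j = 0
  neighbors : ∀ K, G.IsChainComponent K → ∀ i j : K,
    (j : V) ∈ (K \ {(i : V)}) \ G.ne {(i : V)} → (condCov P K (G.pa K))⁻¹ i j = 0

/-- The block-recursive Markov property of `P` with respect to `G`. -/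
structure BlockRecursiveMarkov (G : MixedGraph V) (P : Measure (V → ℝ)) [IsFiniteMeasure P] :
    Prop where
  b1 : ∀ K, G.IsChainComponent K → ∀ i ∈ K,
    CondIndepGiven P {i} (((G.nd K \ K) \ G.fa K) \ G.mo {i}) (G.fa K ∪ G.mo {i})
  b2 : ∀ K, G.IsChainComponent K → ∀ i ∈ K,
    CondIndepGiven P {i} (((G.nd K \ K) \ G.fa {i}) \ G.mo K) ((K \ {i}) ∪ G.fa {i} ∪ G.mo K)
  b3 : ∀ K, G.IsChainComponent K → ∀ i ∈ K, ∀ j ∈ (K \ {i}) \ G.ne {i},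
    CondIndepGiven P {i} {j} ((K \ {i, j}) ∪ G.pa K)

end Distribution

/-!
Everything is expressed through residuals of linear regressions. Since the residual of a Gaussian
variable on `C` is independent of `C`, and subtracting a function of `C` does not affect conditional
independence given `C`, the relation `i ⊥ B | C` says that the residual of `i` on `C` is
uncorrelated with `B`.

Regress each node on the parents of its chain component. The residuals are a unitriangular
transform of the variables, with respect to the number of ancestors, so the quadratic form of `Σ⁻¹`
at `y` is that of the inverse residual covariance matrix at the residuals of `y`. Comparing Gaussian
densities, `P` factorizes iff the residual covariance matrix is block diagonal along the chain
components, i.e. iff the residual of each `i ∈ K` on `Pa(K)` is uncorrelated with `Nd(K) \ K`.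

Such uncorrelatedness on a set `C` of regressors is equivalent to the one on a larger set `C'`
together with the vanishing of the regression coefficients on `C' \ C`. With `C' = Pa(K)` in (B1)
and `C' = (K ∪ Pa(K)) \ {i}` in (B2) and (B3), these coefficients are the entries in the zero
restrictions: up to a nonzero factor, the off-diagonal entries of row `i` of a precision matrix are
the coefficients of the regression of `i` on the other variables.
-/

open Matrix

section MatrixPreliminaries

variable {ι m n R : Type*} {κ : ι → Type*}

lemma eq_of_dotProduct_mulVec_self_eq [Fintype n] [Field R] [NeZero (2 : R)]
    {M N : Matrix n n R} (hM : M.IsSymm) (hN : N.IsSymm)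
    (h : ∀ u : n → R, u ⬝ᵥ M *ᵥ u = u ⬝ᵥ N *ᵥ u) : M = N := by
  classical
  exact toBilin'.injective <| LinearMap.BilinForm.ext_of_isSymm
    (isSymm_toBilin'_iff_isSymm.2 hM) (isSymm_toBilin'_iff_isSymm.2 hN) fun u => by
      simpa only [toBilin'_apply'] using h u

lemma extend_zero_dotProduct [Fintype m] [Fintype n] [NonUnitalNonAssocSemiring R] {e : m → n}
    (he : Function.Injective e) (c : m → R) (y : n → R) :
    Function.extend e c 0 ⬝ᵥ y = c ⬝ᵥ (y ∘ e) := by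
  refine (Fintype.sum_of_injective e he _ _ (fun j hj => ?_) fun a => ?_).symm
  · rw [Function.extend_apply' _ _ _ fun ⟨a, ha⟩ => hj ⟨a, ha⟩, Pi.zero_apply, zero_mul]
  · rw [he.extend_apply, Function.comp_apply]

lemma dotProduct_blockDiagonal'_mulVec [Fintype ι] [DecidableEq ι] [∀ k, Fintype (κ k)]
    [CommSemiring R] (M : ∀ k, Matrix (κ k) (κ k) R) (u : (Σ k, κ k) → R) :
    u ⬝ᵥ blockDiagonal' M *ᵥ u = ∑ k, (fun a => u ⟨k, a⟩) ⬝ᵥ M k *ᵥ fun a => u ⟨k, a⟩ := by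
  simp only [dotProduct, Fintype.sum_sigma, mulVec]
  refine Finset.sum_congr rfl fun k _ => Finset.sum_congr rfl fun a _ => congrArg _ ?_
  rw [Finset.sum_eq_single_of_mem k (Finset.mem_univ k)]
  · simp only [blockDiagonal'_apply_eq]
  · intro l _ hl
    exact Finset.sum_eq_zero fun b _ => by rw [blockDiagonal'_apply_ne _ _ _ hl.symm, zero_mul]

variable [CommRing R]

lemma det_blockDiagonal' [Fintype ι] [DecidableEq ι] [∀ k, Fintype (κ k)]
    [∀ k, DecidableEq (κ k)] (M : ∀ k, Matrix (κ k) (κ k) R) :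
    (blockDiagonal' M).det = ∏ k, (M k).det := by
  let _ : LinearOrder ι := LinearOrder.lift' (Fintype.equivFin ι) (Fintype.equivFin ι).injective
  rw [(blockTriangular_blockDiagonal' M).det_fintype]
  refine Finset.prod_congr rfl fun k _ => ?_
  rw [← det_submatrix_equiv_self (Equiv.sigmaSubtype k).symm]
  exact congrArg det (Matrix.ext fun a b => blockDiagonal'_apply_eq M k a b)

lemma inv_blockDiagonal' [Fintype ι] [DecidableEq ι] [∀ k, Fintype (κ k)]
    [∀ k, DecidableEq (κ k)] {M : ∀ k, Matrix (κ k) (κ k) R} (hM : ∀ k, IsUnit (M k).det) :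
    (blockDiagonal' M)⁻¹ = blockDiagonal' fun k => (M k)⁻¹ := by
  refine inv_eq_left_inv ?_
  rw [← blockDiagonal'_mul, ← blockDiagonal'_one]
  exact congrArg _ (funext fun k => nonsing_inv_mul _ (hM k))

section Schur

variable [Fintype m] [Fintype n] [DecidableEq m] [DecidableEq n]
  {A : Matrix m m R} {B : Matrix m n R} {C : Matrix n m R} {D : Matrix n n R}

lemma inv_fromBlocks_of_isUnit (hD : IsUnit D) (hS : IsUnit (A - B * D⁻¹ * C)) :
    (fromBlocks A B C D)⁻¹ =
      fromBlocks (A - B * D⁻¹ * C)⁻¹ (-((A - B * D⁻¹ * C)⁻¹ * B * D⁻¹))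
        (-(D⁻¹ * C * (A - B * D⁻¹ * C)⁻¹))
        (D⁻¹ + D⁻¹ * C * (A - B * D⁻¹ * C)⁻¹ * B * D⁻¹) := by
  have := hD.invertible
  rw [← invOf_eq_nonsing_inv D] at hS ⊢
  have := hS.invertible
  have := fromBlocks₂₂Invertible A B C D
  rw [← invOf_eq_nonsing_inv, ← invOf_eq_nonsing_inv (_ - _), invOf_fromBlocks₂₂_eq]

lemma dotProduct_inv_fromBlocks_mulVec (hD : IsUnit D) (hDt : D.IsSymm)
    (hS : IsUnit (A - B * D⁻¹ * Bᵀ)) (x : m → R) (y : n → R) :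
    Sum.elim x y ⬝ᵥ (fromBlocks A B Bᵀ D)⁻¹ *ᵥ Sum.elim x y =
      (x - (B * D⁻¹) *ᵥ y) ⬝ᵥ (A - B * D⁻¹ * Bᵀ)⁻¹ *ᵥ (x - (B * D⁻¹) *ᵥ y) + y ⬝ᵥ D⁻¹ *ᵥ y := by
  have hDt' : (D⁻¹)ᵀ = D⁻¹ := by rw [transpose_nonsing_inv, hDt.eq]
  rw [inv_fromBlocks_of_isUnit hD hS, fromBlocks_mulVec]
  set E := (A - B * D⁻¹ * Bᵀ)⁻¹
  have hadj (u : m → R) : (B * D⁻¹) *ᵥ y ⬝ᵥ u = y ⬝ᵥ D⁻¹ *ᵥ Bᵀ *ᵥ u := by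
    rw [dotProduct_comm, dotProduct_mulVec, ← mulVec_transpose, dotProduct_comm, transpose_mul,
      hDt', mulVec_mulVec]
  simp only [sumElim_dotProduct_sumElim, Sum.elim_comp_inl, Sum.elim_comp_inr, add_mulVec,
    neg_mulVec, mulVec_sub, dotProduct_add, dotProduct_sub, sub_dotProduct, dotProduct_neg, hadj]
  simp only [← mulVec_mulVec]
  ring

end Schur

end MatrixPreliminaries

section Regression

variable {V : Type*} {S : Matrix V V ℝ} {A B B' C C' K N : Finset V} {i j : V}

/-- The block of `S` with rows `A` and columns `B`. -/
abbrev block (S : Matrix V V ℝ) (A B : Finset V) : Matrix A B ℝ :=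
  S.submatrix (↑) (↑)

lemma posDef_block (hS : S.PosDef) (A : Finset V) : (block S A A).PosDef :=
  hS.submatrix Subtype.val_injective

lemma isSymm_of_posDef (hS : S.PosDef) : S.IsSymm :=
  isHermitian_iff_isSymm.1 hS.isHermitian

lemma eq_zero_of_vecMul_eq_zero_on [Fintype V] (hS : S.PosDef) {u : V → ℝ} (hu : ∀ j ∉ A, u j = 0)
    (h : ∀ j ∈ A, (u ᵥ* S) j = 0) : u = 0 := by
  by_contra hne
  refine (hS.dotProduct_mulVec_pos hne).ne' ?_
  rw [star_trivial, dotProduct_mulVec]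
  refine Finset.sum_eq_zero fun j _ => ?_
  by_cases hj : j ∈ A
  · rw [h j hj, zero_mul]
  · rw [hu j hj, mul_zero]

variable [DecidableEq V]

/-- The coefficient vector of the residual of the linear regression of the variable `i` on the
variables in `A` when the covariance matrix is `S`: for a random vector `X` the residual is
`resid S A i ⬝ᵥ X`, up to a constant. -/
noncomputable def resid (S : Matrix V V ℝ) (A : Finset V) (i : V) : V → ℝ :=
  Pi.single i 1 - Function.extend Subtype.val ((fun a : A => S i a) ᵥ* (block S A A)⁻¹) 0

lemma resid_apply_of_notMem (hj : j ∉ A) : resid S A i j = (Pi.single i 1 : V → ℝ) j := by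
  rw [resid, Pi.sub_apply, Function.extend_apply' _ _ _ fun ⟨a, ha⟩ => hj (ha ▸ a.2),
    Pi.zero_apply, sub_zero]

lemma resid_apply_coe (hi : i ∉ A) (j : A) :
    resid S A i j = -((fun a : A => S i a) ᵥ* (block S A A)⁻¹) j := by
  have hji : (j : V) ≠ i := fun h => hi (h ▸ j.2)
  rw [resid, Pi.sub_apply, Subtype.val_injective.extend_apply, Pi.single_eq_of_ne hji, zero_sub]

variable [Fintype V]

lemma resid_dotProduct (y : V → ℝ) :
    resid S A i ⬝ᵥ y = y i - ((fun a : A => S i a) ᵥ* (block S A A)⁻¹) ⬝ᵥ fun a : A => y a := by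
  rw [resid, sub_dotProduct, single_one_dotProduct,
    extend_zero_dotProduct Subtype.val_injective]
  rfl

lemma resid_vecMul_apply_of_mem (hS : S.PosDef) (i : V) (hj : j ∈ A) :
    (resid S A i ᵥ* S) j = 0 := by
  have h : ((fun a : A => S i a) ᵥ* (block S A A)⁻¹ ᵥ* block S A A) ⟨j, hj⟩ = S i j := by
    rw [vecMul_vecMul, nonsing_inv_mul _ (posDef_block hS A).det_pos.ne'.isUnit, vecMul_one]
  exact (resid_dotProduct _).trans (sub_eq_zero.2 h.symm)

lemma eq_resid (hS : S.PosDef) {w : V → ℝ} (hw : ∀ j ∉ A, w j = (Pi.single i 1 : V → ℝ) j)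
    (h : ∀ j ∈ A, (w ᵥ* S) j = 0) : w = resid S A i := by
  refine sub_eq_zero.1 (eq_zero_of_vecMul_eq_zero_on hS (A := A) (fun j hj => ?_) fun j hj => ?_)
  · rw [Pi.sub_apply, hw j hj, resid_apply_of_notMem hj, sub_self]
  · rw [sub_vecMul, Pi.sub_apply, h j hj, resid_vecMul_apply_of_mem hS i hj, sub_self]

/-- The residual of the linear regression of `i` on the variables in `C` is uncorrelated with every
variable in `B` when the covariance matrix is `S`. -/
def ResidUncorr (S : Matrix V V ℝ) (C : Finset V) (i : V) (B : Finset V) : Prop :=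
  ∀ j ∈ B, (resid S C i ᵥ* S) j = 0

lemma residUncorr_iff_of_subset (hS : S.PosDef) (hC : C ⊆ C') (hi : i ∉ C') (hCB : C' \ C ⊆ B)
    (hB : B ⊆ B' ∪ C') (hB' : B' ⊆ B ∪ C') :
    ResidUncorr S C i B ↔ (∀ j ∈ C' \ C, resid S C' i j = 0) ∧ ResidUncorr S C' i B' := by
  have single_eq_zero {j : V} (hj : j ∈ C') : (Pi.single i 1 : V → ℝ) j = 0 :=
    Pi.single_eq_of_ne (ne_of_mem_of_not_mem hj hi) 1
  constructor
  · intro h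
    have heq : resid S C i = resid S C' i := by
      refine eq_resid hS (fun j hj => resid_apply_of_notMem fun hj' => hj (hC hj')) fun j hj => ?_
      by_cases hj' : j ∈ C
      · exact resid_vecMul_apply_of_mem hS i hj'
      · exact h j (hCB (Finset.mem_sdiff.2 ⟨hj, hj'⟩))
    refine ⟨fun j hj => ?_, fun j hj => ?_⟩
    · obtain ⟨hjC', hjC⟩ := Finset.mem_sdiff.1 hj
      rw [← heq, resid_apply_of_notMem hjC, single_eq_zero hjC']
    · rcases Finset.mem_union.1 (hB' hj) with hjB | hjC'
      · exact heq ▸ h j hjB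
      · exact resid_vecMul_apply_of_mem hS i hjC'
  · rintro ⟨hzero, h⟩ j hj
    have heq : resid S C' i = resid S C i := by
      refine eq_resid hS (fun k hk => ?_) fun k hk => resid_vecMul_apply_of_mem hS i (hC hk)
      by_cases hk' : k ∈ C'
      · rw [hzero k (Finset.mem_sdiff.2 ⟨hk', hk⟩), single_eq_zero hk']
      · exact resid_apply_of_notMem hk'
    rcases Finset.mem_union.1 (hB hj) with hjB' | hjC'
    · exact heq ▸ h j hjB'
    · exact heq ▸ resid_vecMul_apply_of_mem hS i hjC'

lemma ResidUncorr.union_sdiff_singleton (hS : S.PosDef) (h : ∀ k ∈ K, ResidUncorr S A k N)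
    (hi : i ∈ K) (hiA : i ∉ A) : ResidUncorr S ((K ∪ A) \ {i}) i N := by
  set w := resid S ((K ∪ A) \ {i}) i
  have hvecMul (j : V) : ((∑ k ∈ K, w k • resid S A k) ᵥ* S) j =
      ∑ k ∈ K, w k * (resid S A k ᵥ* S) j := by
    simp only [sum_vecMul, smul_vecMul, Finset.sum_apply, Pi.smul_apply, smul_eq_mul]
  have hw : w = ∑ k ∈ K, w k • resid S A k := by
    refine sub_eq_zero.1 (eq_zero_of_vecMul_eq_zero_on hS (A := A) (fun l hl => ?_) fun j hj => ?_)
    · have hsum : (∑ k ∈ K, w k • resid S A k) l = if l ∈ K then w l else 0 := by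
        simp [resid_apply_of_notMem hl, Pi.single_apply]
      rw [Pi.sub_apply, hsum]
      split_ifs with hlK
      · exact sub_self _
      · have hlU : l ∉ (K ∪ A) \ {i} := by simp [hlK, hl]
        rw [sub_zero, show w l = _ from resid_apply_of_notMem hlU,
          Pi.single_eq_of_ne (ne_of_mem_of_not_mem hi hlK).symm]
    · have hjU : j ∈ (K ∪ A) \ {i} := by
        simp [hj, ne_of_mem_of_not_mem hj hiA]
      rw [sub_vecMul, Pi.sub_apply, resid_vecMul_apply_of_mem hS i hjU, hvecMul, zero_sub,
        neg_eq_zero]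
      exact Finset.sum_eq_zero fun k _ => by rw [resid_vecMul_apply_of_mem hS k hj, mul_zero]
  intro j hj
  change (w ᵥ* S) j = 0
  rw [hw, hvecMul]
  exact Finset.sum_eq_zero fun k hk => by rw [h k hk j hj, mul_zero]

end Regression

section PrecisionMatrix

variable {V : Type*} [Finite V] [DecidableEq V] {S : Matrix V V ℝ}

lemma inv_block_apply_eq_mul_resid (hS : S.PosDef) {U : Finset V} (i j : U) :
    (block S U U)⁻¹ i j = (block S U U)⁻¹ i i * resid S (U \ {(i : V)}) i j := by
  have := Fintype.ofFinite V
  set Ω := (block S U U)⁻¹ with hΩ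
  have hpos : Ω i i ≠ 0 := (posDef_block hS U).inv.diag_pos.ne'
  have hext (l : U) : Function.extend Subtype.val (Ω i) 0 (l : V) = Ω i l :=
    Subtype.val_injective.extend_apply _ _ _
  have hw : (Ω i i)⁻¹ • Function.extend Subtype.val (Ω i) 0 = resid S (U \ {(i : V)}) i := by
    refine eq_resid hS (fun l hl => ?_) fun k hk => ?_
    · rw [Pi.smul_apply, smul_eq_mul]
      by_cases hli : l = i
      · rw [hli, hext, inv_mul_cancel₀ hpos, Pi.single_eq_same]
      · have hlU : l ∉ U := fun h => hl (by simp [h, hli])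
        rw [Function.extend_apply' _ _ _ fun ⟨a, ha⟩ => hlU (ha ▸ a.2), Pi.zero_apply, mul_zero,
          Pi.single_eq_of_ne hli]
    · obtain ⟨hkU, hki⟩ := Finset.mem_sdiff.1 hk
      have hΩS : (Ω * block S U U) i ⟨k, hkU⟩ = 0 := by
        rw [hΩ, nonsing_inv_mul _ (posDef_block hS U).det_pos.ne'.isUnit]
        exact one_apply_ne fun h => hki (by simp [h])
      have hext_vecMul : (Function.extend Subtype.val (Ω i) 0 ᵥ* S) k = 0 :=
        (extend_zero_dotProduct Subtype.val_injective _ _).trans hΩS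
      rw [smul_vecMul, Pi.smul_apply, hext_vecMul, smul_zero]
  rw [← hw, Pi.smul_apply, hext, smul_eq_mul, mul_inv_cancel_left₀ hpos]

lemma inv_block_apply_eq_zero_iff (hS : S.PosDef) {U : Finset V} (i j : U) :
    (block S U U)⁻¹ i j = 0 ↔ resid S (U \ {(i : V)}) i j = 0 := by
  rw [inv_block_apply_eq_mul_resid hS, mul_eq_zero_iff_left (posDef_block hS U).inv.diag_pos.ne']

end PrecisionMatrix

section SchurComplement

variable {V : Type*} [DecidableEq V] {S : Matrix V V ℝ} {A K : Finset V}

/-- The Schur complement of the block `A` of `S` in the block `K ∪ A`, i.e. the covariance matrix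
of the residuals of the regression of `K` on `A`. -/
noncomputable def schur (S : Matrix V V ℝ) (K A : Finset V) : Matrix K K ℝ :=
  block S K K - block S K A * (block S A A)⁻¹ * block S A K

/-- The quadratic form of the precision matrix of the variables in `A`. -/
noncomputable def precForm (S : Matrix V V ℝ) (A : Finset V) (y : V → ℝ) : ℝ :=
  (fun a : A => y a) ⬝ᵥ (block S A A)⁻¹ *ᵥ fun a : A => y a

lemma fromBlocks_block_eq_submatrix (h : Disjoint K A) :
    fromBlocks (block S K K) (block S K A) (block S A K) (block S A A) =
      (block S (K ∪ A) (K ∪ A)).submatrix (Equiv.Finset.union K A h)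
        (Equiv.Finset.union K A h) := by
  ext (i | i) (j | j) <;> rfl

lemma det_block_union (hS : S.PosDef) (h : Disjoint K A) :
    (block S (K ∪ A) (K ∪ A)).det = (block S A A).det * (schur S K A).det := by
  have := (posDef_block hS A).isUnit.invertible
  rw [← det_submatrix_equiv_self (Equiv.Finset.union K A h), ← fromBlocks_block_eq_submatrix h,
    det_fromBlocks₂₂, invOf_eq_nonsing_inv, schur]

lemma isUnit_schur (hS : S.PosDef) (h : Disjoint K A) : IsUnit (schur S K A) := by
  refine (isUnit_iff_isUnit_det _).2 (IsUnit.mk0 _ fun h0 => ?_)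
  refine (posDef_block hS (K ∪ A)).det_pos.ne' ?_
  rw [det_block_union hS h, h0, mul_zero]

lemma inv_block_union_apply (hS : S.PosDef) (h : Disjoint K A) (i j : K) :
    (block S (K ∪ A) (K ∪ A))⁻¹ ⟨i, Finset.mem_union_left A i.2⟩
      ⟨j, Finset.mem_union_left A j.2⟩ = (schur S K A)⁻¹ i j := by
  have hinv := inv_fromBlocks_of_isUnit (posDef_block hS A).isUnit (isUnit_schur hS h)
  rw [fromBlocks_block_eq_submatrix h, inv_submatrix_equiv] at hinv
  exact congrFun₂ hinv (.inl i) (.inl j)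

lemma posDef_schur (hS : S.PosDef) (h : Disjoint K A) : (schur S K A).PosDef := by
  have hinv : (schur S K A)⁻¹ = (block S (K ∪ A) (K ∪ A))⁻¹.submatrix
      (Set.inclusion Finset.subset_union_left) (Set.inclusion Finset.subset_union_left) :=
    Matrix.ext fun i j => (inv_block_union_apply hS h i j).symm
  have hpd : (schur S K A)⁻¹.PosDef :=
    hinv ▸ (posDef_block hS (K ∪ A)).inv.submatrix (Set.inclusion_injective _)
  rw [← nonsing_inv_nonsing_inv _ ((isUnit_iff_isUnit_det _).1 (isUnit_schur hS h))]
  exact hpd.inv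

variable [Fintype V]

lemma schur_apply (i j : K) : schur S K A i j = (resid S A i ᵥ* S) j :=
  (resid_dotProduct fun l => S l j).symm

lemma precForm_union (hS : S.PosDef) (h : Disjoint K A) (y : V → ℝ) :
    precForm S (K ∪ A) y = (fun i : K => resid S A i ⬝ᵥ y) ⬝ᵥ
      (schur S K A)⁻¹ *ᵥ (fun i : K => resid S A i ⬝ᵥ y) + precForm S A y := by
  have hAK : block S A K = (block S K A)ᵀ :=
    Matrix.ext fun _ _ => ((isSymm_of_posDef hS).apply _ _).symm
  have hsq := dotProduct_inv_fromBlocks_mulVec (posDef_block hS A).isUnit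
    (isSymm_of_posDef (posDef_block hS A)) (by rw [← hAK]; exact isUnit_schur hS h)
    (fun i : K => y i) fun a : A => y a
  have hunion : (Sum.elim (fun i : K => y i) fun a : A => y a) =
      (fun u : (K ∪ A : Finset V) => y u) ∘ Equiv.Finset.union K A h := by
    ext (i | a) <;> rfl
  have hresid : (fun i : K => y i) - (block S K A * (block S A A)⁻¹) *ᵥ (fun a : A => y a) =
      fun i : K => resid S A i ⬝ᵥ y :=
    funext fun i => (resid_dotProduct y).symm
  rw [← hAK, fromBlocks_block_eq_submatrix h, inv_submatrix_equiv, hresid, hunion,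
    submatrix_mulVec_equiv, comp_equiv_dotProduct_comp_equiv, Function.comp_assoc,
    Equiv.self_comp_symm, Function.comp_id] at hsq
  exact hsq

end SchurComplement

section ResidualSystem

variable {V : Type*} [Fintype V] [DecidableEq V] {S : Matrix V V ℝ} {π : V → Finset V}

/-- The matrix whose `i`-th row gives the residual of the regression of `i` on `π i`. -/
noncomputable def residMat (S : Matrix V V ℝ) (π : V → Finset V) : Matrix V V ℝ :=
  Matrix.of fun i => resid S (π i) i

/-- The covariance matrix of the residuals of the regressions of the variables `i` on `π i`. -/
noncomputable def residCov (S : Matrix V V ℝ) (π : V → Finset V) : Matrix V V ℝ :=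
  residMat S π * S * (residMat S π)ᵀ

lemma det_residMat {rank : V → ℕ} (hrank : ∀ i, ∀ l ∈ π i, rank l < rank i) :
    (residMat S π).det = 1 := by
  have heq_one {i j : V} (hij : rank i ≤ rank j) : residMat S π i j = (1 : Matrix V V ℝ) i j := by
    rw [residMat, of_apply, resid_apply_of_notMem fun hj => (hrank i j hj).not_ge hij,
      one_eq_pi_single]
  have htri : (residMat S π).BlockTriangular (OrderDual.toDual ∘ rank) := by
    intro i j (hij : rank i < rank j)
    rw [heq_one hij.le, one_apply_ne fun h => (h ▸ hij).false]
  rw [htri.det]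
  refine Finset.prod_eq_one fun a _ => ?_
  have hblock : (residMat S π).toSquareBlock (OrderDual.toDual ∘ rank) a = 1 := by
    ext ⟨i, hi⟩ ⟨j, hj⟩
    rw [toSquareBlock_def, of_apply,
      heq_one (OrderDual.toDual.injective (hi.trans hj.symm)).le]
    simp only [one_apply, Subtype.mk.injEq]
  rw [hblock, det_one]

lemma det_residCov (hR : (residMat S π).det = 1) : (residCov S π).det = S.det := by
  rw [residCov, det_mul, det_mul, det_transpose, hR, one_mul, mul_one]

lemma posDef_residCov (hS : S.PosDef) (hR : (residMat S π).det = 1) : (residCov S π).PosDef := by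
  have hinj : Function.Injective (residMat S π).vecMul :=
    vecMul_injective_iff_isUnit.2 ((isUnit_iff_isUnit_det _).2 (hR ▸ isUnit_one))
  simpa only [residCov, conjTranspose_eq_transpose_of_trivial] using
    hS.mul_mul_conjTranspose_same hinj

lemma dotProduct_inv_mulVec_eq_residCov (hR : (residMat S π).det = 1) (y : V → ℝ) :
    y ⬝ᵥ S⁻¹ *ᵥ y =
      (residMat S π *ᵥ y) ⬝ᵥ (residCov S π)⁻¹ *ᵥ (residMat S π *ᵥ y) := by
  have hRu : IsUnit (residMat S π).det := hR ▸ isUnit_one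
  have hinv : S⁻¹ = (residMat S π)ᵀ * (residCov S π)⁻¹ * residMat S π := by
    rw [residCov, Matrix.mul_inv_rev, Matrix.mul_inv_rev,
      mul_nonsing_inv_cancel_left _ _ (by rwa [det_transpose]),
      nonsing_inv_mul_cancel_right _ _ hRu]
  rw [hinv, ← mulVec_mulVec, ← mulVec_mulVec, dotProduct_mulVec, vecMul_transpose]

lemma residCov_apply (i j : V) :
    residCov S π i j = resid S (π j) j ⬝ᵥ (resid S (π i) i ᵥ* S) := by
  rw [dotProduct_comm]
  rfl

lemma residCov_apply_of_uncorr {i j : V} (h : ∀ l ∈ π j, (resid S (π i) i ᵥ* S) l = 0) :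
    residCov S π i j = (resid S (π i) i ᵥ* S) j := by
  rw [residCov_apply, resid_dotProduct, sub_eq_self]
  exact Finset.sum_eq_zero fun l _ => mul_eq_zero_of_right _ (h l l.2)

lemma residUncorr_iff_residCov {rank : V → ℕ} (hrank : ∀ i, ∀ l ∈ π i, rank l < rank i) (i : V)
    {N : Finset V} (hN : ∀ j ∈ N, π j ⊆ N) :
    ResidUncorr S (π i) i N ↔ ∀ j ∈ N, residCov S π i j = 0 := by
  constructor
  · intro h j hj
    rw [residCov_apply_of_uncorr fun l hl => h l (hN j hj hl), h j hj]
  · intro h j hj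
    induction hn : rank j using Nat.strong_induction_on generalizing j with
    | _ n ih =>
      rw [← residCov_apply_of_uncorr fun l hl => ih _ (hn ▸ hrank j l hl) l (hN j hj hl) rfl,
        h j hj]

end ResidualSystem

section ConditionalIndependence

variable {Ω β γ δ : Type*} {m' mΩ : MeasurableSpace Ω} {hm' : m' ≤ mΩ} {μ : Measure Ω}
  [MeasurableSpace β] [MeasurableSpace γ] [MeasurableSpace δ]

lemma condDistrib_ae_eq_const_iff [IsProbabilityMeasure μ] [StandardBorelSpace β] [Nonempty β]
    {f : Ω → β} {k : Ω → δ} (hf : Measurable f) (hk : Measurable k) :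
    condDistrib f k μ =ᵐ[μ.map k] Kernel.const _ (μ.map f) ↔ IndepFun k f μ := by
  have : IsProbabilityMeasure (μ.map f) := Measure.isProbabilityMeasure_map hf.aemeasurable
  rw [condDistrib_ae_eq_iff_measure_eq_compProd _ hf.aemeasurable,
    indepFun_iff_map_prod_eq_prod_map_map hk.aemeasurable hf.aemeasurable,
    Measure.compProd_const]

variable [StandardBorelSpace Ω]

lemma condIndepFun_iff_indepFun_prodMk [IsProbabilityMeasure μ] [StandardBorelSpace β] [Nonempty β]
    [StandardBorelSpace γ] [Nonempty γ] {f : Ω → β} {g : Ω → γ} {k : Ω → δ} (hf : Measurable f)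
    (hg : Measurable g) (hk : Measurable k) (hkf : IndepFun k f μ) :
    CondIndepFun (MeasurableSpace.comap k inferInstance) hk.comap_le f g μ ↔
      IndepFun (fun ω => (k ω, g ω)) f μ := by
  have hconst : (condDistrib f k μ).prodMkRight γ =ᵐ[μ.map fun ω => (k ω, g ω)]
      Kernel.const _ (μ.map f) := by
    have hfst : Measure.QuasiMeasurePreserving Prod.fst (μ.map fun ω => (k ω, g ω)) (μ.map k) :=
      ⟨measurable_fst, by
        rw [Measure.map_map measurable_fst (hk.prodMk hg)]
        exact Measure.AbsolutelyContinuous.rfl⟩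
    filter_upwards [hfst.ae ((condDistrib_ae_eq_const_iff hf hk).2 hkf)] with p hp
    simpa using hp
  rw [← condDistrib_ae_eq_const_iff hf (hk.prodMk hg)]
  constructor
  · intro h
    exact ((condIndepFun_iff_condDistrib_prod_ae_eq_prodMkRight hf hg hk).1 h.symm).trans hconst
  · intro h
    exact ((condIndepFun_iff_condDistrib_prod_ae_eq_prodMkRight hf hg hk).2
      (h.trans hconst.symm)).symm

variable [IsFiniteMeasure μ]

lemma condExpKernel_ae_eq_self [MeasurableEq δ] {h : Ω → δ} (hm' : m' ≤ mΩ)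
    (hh : Measurable[m'] h) :
    ∀ᵐ ω ∂μ.trim hm', ∀ᵐ ω' ∂condExpKernel μ m' ω, h ω' = h ω := by
  have hmeas : @MeasurableSet (Ω × Ω) (m'.prod mΩ) {p | h p.2 = h p.1} :=
    @measurableSet_eq_fun _ _ (m'.prod mΩ) _ _ _ _
      ((hh.mono hm' le_rfl).comp (@measurable_snd _ _ m' mΩ)) (hh.comp measurable_fst)
  have hdiag : @Measurable Ω (Ω × Ω) mΩ (m'.prod mΩ) fun ω => (ω, ω) :=
    @Measurable.prodMk Ω mΩ Ω Ω m' mΩ _ _ (measurable_id.mono le_rfl hm') measurable_id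
  refine Measure.ae_ae_of_ae_compProd (p := fun p : Ω × Ω => h p.2 = h p.1) ?_
  rw [compProd_trim_condExpKernel]
  exact (@ae_map_iff Ω (Ω × Ω) mΩ (m'.prod mΩ) μ _
    (@Measurable.aemeasurable _ _ mΩ (m'.prod mΩ) _ μ hdiag) _ hmeas).2 (by simp)

lemma condIndepFun_iff_ae_indepFun [StandardBorelSpace β] [StandardBorelSpace γ] {f : Ω → β}
    {g : Ω → γ} (hf : Measurable f) (hg : Measurable g) :
    CondIndepFun m' hm' f g μ ↔ ∀ᵐ ω ∂μ.trim hm', IndepFun f g (condExpKernel μ m' ω) := by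
  rw [condIndepFun_iff_map_prod_eq_prod_map_map hf hg]
  refine Filter.eventually_congr (Filter.Eventually.of_forall fun ω => ?_)
  rw [Kernel.map_apply _ (by fun_prop), Kernel.prod_apply, Kernel.map_apply _ hf,
    Kernel.map_apply _ hg, indepFun_iff_map_prod_eq_prod_map_map hf.aemeasurable hg.aemeasurable]

lemma condIndepFun_sub_iff [StandardBorelSpace β] [StandardBorelSpace γ] [AddGroup β]
    [MeasurableAdd β] [MeasurableSub₂ β] [MeasurableEq β] {f h : Ω → β} {g : Ω → γ}
    (hf : Measurable f) (hg : Measurable g) (hh : Measurable[m'] h) :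
    CondIndepFun m' hm' (fun ω => f ω - h ω) g μ ↔ CondIndepFun m' hm' f g μ := by
  have hfh : Measurable fun ω => f ω - h ω := hf.sub (hh.mono hm' le_rfl)
  rw [condIndepFun_iff_ae_indepFun hfh hg, condIndepFun_iff_ae_indepFun hf hg]
  refine Filter.eventually_congr ?_
  filter_upwards [condExpKernel_ae_eq_self hm' hh] with ω hω
  constructor
  · intro hindep
    refine (hindep.comp (φ := fun b => b + h ω) (ψ := id) (by fun_prop) measurable_id).congr ?_ .rfl
    filter_upwards [hω] with ω' hω'
    simp [hω']
  · intro hindep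
    refine (hindep.comp (φ := fun b => b - h ω) (ψ := id) (by fun_prop) measurable_id).congr ?_ .rfl
    filter_upwards [hω] with ω' hω'
    simp [hω']

end ConditionalIndependence

section GaussianIndependence

variable {V : Type*} (P : Measure (V → ℝ)) [IsGaussian P]

lemma memLp_two_eval [Finite V] (i : V) : MemLp (fun x : V → ℝ => x i) 2 P :=
  have := Fintype.ofFinite V
  ((IsGaussian.hasGaussianLaw_id (μ := P)).map_fun (ContinuousLinearMap.proj (R := ℝ) i)).memLp_two

variable [Fintype V]

lemma covariance_dotProduct (w u : V → ℝ) :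
    cov[fun x => w ⬝ᵥ x, fun x => u ⬝ᵥ x; P] = (w ᵥ* covMat P) ⬝ᵥ u := by
  simp only [dotProduct, vecMul]
  rw [covariance_fun_sum_fun_sum (fun i => (memLp_two_eval P i).const_mul _)
    fun i => (memLp_two_eval P i).const_mul _, Finset.sum_comm]
  simp_rw [covariance_const_mul_left, covariance_const_mul_right, Finset.sum_mul, mul_assoc,
    mul_comm (u _)]
  rfl

lemma indepFun_restrict_mulVec_iff {ι : Type*} [Finite ι] (R : Matrix ι V ℝ) (C : Finset V) :
    IndepFun (C.restrict (π := fun _ => ℝ)) (fun x => R *ᵥ x) P ↔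
      ∀ i, ∀ j ∈ C, (R i ᵥ* covMat P) j = 0 := by
  classical
  have := Fintype.ofFinite ι
  have hcov (i : ι) (j : V) :
      cov[fun x => x j, fun x => (R *ᵥ x) i; P] = (R i ᵥ* covMat P) j := by
    rw [covariance_comm]
    simpa using! covariance_dotProduct P (R i) (Pi.single j 1)
  constructor
  · intro h i j hj
    have hij : IndepFun (fun x : V → ℝ => x j) (fun x => (R *ᵥ x) i) P :=
      h.comp (φ := fun y : C → ℝ => y ⟨j, hj⟩) (ψ := fun y : ι → ℝ => y i) (by fun_prop)
        (by fun_prop)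
    rw [← hcov]
    exact hij.covariance_eq_zero (memLp_two_eval P j)
      (memLp_finsetSum _ fun l _ => (memLp_two_eval P l).const_mul _)
  · intro h
    let L : (V → ℝ) →L[ℝ] (C → ℝ) × (ι → ℝ) :=
      (ContinuousLinearMap.pi fun c : C => ContinuousLinearMap.proj (R := ℝ) (c : V)).prod
        R.mulVecLin.toContinuousLinearMap
    have hlaw : HasGaussianLaw L P := (IsGaussian.hasGaussianLaw_id (μ := P)).map_fun L
    exact hlaw.indepFun_of_covariance_eval (X := fun (c : C) (x : V → ℝ) => x c)
      (Y := fun i x => (R *ᵥ x) i) fun c i => (hcov i c).trans (h i c c.2)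

variable {P}

theorem condIndepGiven_iff [DecidableEq V] (hP : (covMat P).PosDef) (A B C : Finset V) :
    CondIndepGiven P A B C ↔ ∀ i ∈ A, ResidUncorr (covMat P) C i B := by
  have hA : Measurable (A.restrict (π := fun _ : V => ℝ)) := Finset.measurable_restrict A
  have hB : Measurable (B.restrict (π := fun _ : V => ℝ)) := Finset.measurable_restrict B
  have hC : Measurable (C.restrict (π := fun _ : V => ℝ)) := Finset.measurable_restrict C
  let R : Matrix A V ℝ := Matrix.of fun i => resid (covMat P) C i
  have hR : Measurable fun x => R *ᵥ x := by fun_prop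
  let fit (y : C → ℝ) (i : A) : ℝ :=
    ((fun c : C => covMat P i c) ᵥ* (block (covMat P) C C)⁻¹) ⬝ᵥ y
  have hfit : Measurable[MeasurableSpace.comap (C.restrict (π := fun _ : V => ℝ)) inferInstance]
      fun x => fit (C.restrict x) :=
    Measurable.comp (g := fit) (by fun_prop) (comap_measurable _)
  have hsub : (fun x => R *ᵥ x) = fun x : V → ℝ => A.restrict x - fit (C.restrict x) :=
    funext₂ fun x i => resid_dotProduct x
  have hindep : IndepFun (C.restrict (π := fun _ => ℝ)) (fun x => R *ᵥ x) P :=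
    (indepFun_restrict_mulVec_iff P R C).2 fun i _ hj => resid_vecMul_apply_of_mem hP i hj
  rw [CondIndepGiven, ← condIndepFun_sub_iff hA hB hfit, ← hsub,
    condIndepFun_iff_indepFun_prodMk hR hB hC hindep]
  constructor
  · intro h i hi j hj
    exact (indepFun_restrict_mulVec_iff P R B).1
      (h.comp (φ := Prod.snd) (ψ := id) measurable_snd measurable_id) ⟨i, hi⟩ j hj
  · intro h
    have hunion : IndepFun ((C ∪ B).restrict (π := fun _ => ℝ)) (fun x => R *ᵥ x) P :=
      (indepFun_restrict_mulVec_iff P R (C ∪ B)).2 fun i j hj =>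
        (Finset.mem_union.1 hj).elim (resid_vecMul_apply_of_mem hP i) (h i i.2 j)
    exact hunion.comp (φ := fun y : (C ∪ B : Finset V) → ℝ =>
      ((fun c : C => y ⟨c, Finset.mem_union_left B c.2⟩),
        fun b : B => y ⟨b, Finset.mem_union_right C b.2⟩)) (ψ := id) (by fun_prop) measurable_id

end GaussianIndependence

section GaussianWeight

/-- The value of an `n`-dimensional Gaussian density whose covariance matrix has determinant `d`, at
a point where the quadratic form of the precision matrix takes the value `q`. -/
noncomputable def gaussianWeight (n : ℕ) (d q : ℝ) : ℝ :=
  (√(2 * Real.pi) ^ n)⁻¹ * (√d)⁻¹ * Real.exp (-q / 2)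

variable {n m : ℕ} {d e q r : ℝ}

lemma gaussianWeight_pos (hd : 0 < d) : 0 < gaussianWeight n d q := by
  unfold gaussianWeight
  positivity

lemma continuous_gaussianWeight : Continuous (gaussianWeight n d) := by
  unfold gaussianWeight
  fun_prop

lemma gaussianWeight_add (hd : 0 ≤ d) :
    gaussianWeight (n + m) (d * e) (q + r) = gaussianWeight n d q * gaussianWeight m e r := by
  have hexp : Real.exp (-(q + r) / 2) = Real.exp (-q / 2) * Real.exp (-r / 2) := by
    rw [← Real.exp_add]
    ring_nf
  rw [gaussianWeight, gaussianWeight, gaussianWeight, hexp, Real.sqrt_mul hd, pow_add, mul_inv,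
    mul_inv]
  ring

lemma prod_gaussianWeight {κ : Type*} (s : Finset κ) (n : κ → ℕ) {d : κ → ℝ} (hd : ∀ k, 0 ≤ d k)
    (q : κ → ℝ) :
    ∏ k ∈ s, gaussianWeight (n k) (d k) (q k) =
      gaussianWeight (∑ k ∈ s, n k) (∏ k ∈ s, d k) (∑ k ∈ s, q k) := by
  classical
  induction s using Finset.induction_on with
  | empty => simp [gaussianWeight]
  | insert k s hk ih =>
    simp only [Finset.prod_insert hk, Finset.sum_insert hk, gaussianWeight_add (hd k), ih]

lemma gaussianPDFReal_one (μ x : ℝ) :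
    gaussianPDFReal μ 1 x = gaussianWeight 1 1 ((x - μ) ^ 2) := by
  simp [gaussianPDFReal, gaussianWeight]

lemma forall_gaussianWeight_eq_iff {Y : Type*} {f g : Y → ℝ} {y₀ : Y} (hfg : f y₀ = g y₀)
    (hd : 0 < d) (he : 0 < e) :
    (∀ y, gaussianWeight n d (f y) = gaussianWeight n e (g y)) ↔ d = e ∧ ∀ y, f y = g y := by
  refine ⟨fun h => ?_, fun ⟨hde, h⟩ y => by rw [hde, h y]⟩
  have hπ : (√(2 * Real.pi) ^ n)⁻¹ ≠ 0 := by positivity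
  have hde : d = e := by
    have h₀ := h y₀
    rw [hfg, gaussianWeight, gaussianWeight] at h₀
    exact (Real.sqrt_inj hd.le he.le).1
      (inv_injective (mul_left_cancel₀ hπ (mul_right_cancel₀ (Real.exp_pos _).ne' h₀)))
  refine ⟨hde, fun y => ?_⟩
  have hy := h y
  rw [hde, gaussianWeight, gaussianWeight] at hy
  have hsqrt : (√e)⁻¹ ≠ 0 := (inv_pos.2 (Real.sqrt_pos.2 he)).ne'
  linarith [Real.exp_injective (mul_left_cancel₀ (mul_ne_zero hπ hsqrt) hy)]

end GaussianWeight

section GaussianDensity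

variable {ι : Type*} [Fintype ι]

lemma pi_gaussianReal_eq_withDensity (μ : ι → ℝ) :
    Measure.pi (fun i => gaussianReal (μ i) 1) = (volume : Measure (ι → ℝ)).withDensity
      fun x => ENNReal.ofReal (∏ i, gaussianPDFReal (μ i) 1 (x i)) := by
  refine Measure.pi_eq fun s hs => ?_
  rw [withDensity_apply _ (MeasurableSet.univ_pi hs), volume_pi, Measure.restrict_pi_pi,
    ← ofReal_integral_eq_lintegral_ofReal, integral_fintype_prod_eq_prod,
    ENNReal.ofReal_prod_of_nonneg]
  · exact Finset.prod_congr rfl fun i _ => (gaussianReal_apply_eq_integral _ one_ne_zero _).symm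
  · exact fun i _ => integral_nonneg fun x => gaussianPDFReal_nonneg _ _ _
  · exact Integrable.fintype_prod fun i => (integrable_gaussianPDFReal _ _).restrict
  · exact Filter.Eventually.of_forall fun x =>
      Finset.prod_nonneg fun i _ => gaussianPDFReal_nonneg _ _ _

/-- The mean vector of `P`. -/
noncomputable def meanVec (P : Measure (ι → ℝ)) : ι → ℝ := fun i => ∫ x, x i ∂P

variable [DecidableEq ι]

open scoped MatrixOrder Matrix.Norms.L2Operator in
lemma exists_transpose_mul_self_eq_inv {S : Matrix ι ι ℝ} (hS : S.PosDef) :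
    ∃ W : Matrix ι ι ℝ, Wᵀ * W = S⁻¹ ∧ W * S * Wᵀ = 1 ∧ |W.det| = (√S.det)⁻¹ := by
  obtain ⟨W, hW⟩ := CStarAlgebra.nonneg_iff_eq_star_mul_self.mp hS.inv.posSemidef.nonneg
  rw [star_eq_conjTranspose, conjTranspose_eq_transpose_of_trivial] at hW
  refine ⟨W, hW.symm, ?_, ?_⟩
  · have hleft : Wᵀ * (W * S) = 1 := by
      rw [← mul_assoc, ← hW, nonsing_inv_mul _ hS.det_pos.ne'.isUnit]
    exact mul_eq_one_comm.1 hleft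
  · have hdet := congrArg det hW
    rw [det_mul, det_transpose, det_nonsing_inv, Ring.inverse_eq_inv', ← sq] at hdet
    rw [← Real.sqrt_sq_eq_abs, ← hdet, Real.sqrt_inv]

lemma eq_withDensity_of_map_mulVec {Q : Measure (ι → ℝ)} {W : Matrix ι ι ℝ} (hW : W.det ≠ 0)
    {g : (ι → ℝ) → ENNReal} (hg : Measurable g)
    (h : Q.map (fun x => W *ᵥ x) = volume.withDensity g) :
    Q = volume.withDensity fun x => ENNReal.ofReal |W.det| * g (W *ᵥ x) := by
  have hT : MeasurableEmbedding fun x : ι → ℝ => W *ᵥ x :=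
    Continuous.measurableEmbedding (by fun_prop)
      (mulVec_injective_iff_isUnit.2 ((isUnit_iff_isUnit_det _).2 hW.isUnit))
  have hvol : (volume : Measure (ι → ℝ)).map (fun x => W *ᵥ x) =
      ENNReal.ofReal |W.det⁻¹| • volume := Real.map_matrix_volume_pi_eq_smul_volume_pi hW
  have hgT : Measurable fun x => g (W *ᵥ x) := hg.comp hT.measurable
  refine hT.map_injective ?_
  rw [h]
  ext s hs
  rw [withDensity_apply _ hs, Measure.map_apply hT.measurable hs,
    withDensity_apply _ (hT.measurable hs), lintegral_const_mul _ hgT,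
    ← setLIntegral_map hs hg hT.measurable, hvol, Measure.restrict_smul, lintegral_smul_measure,
    smul_eq_mul, ← mul_assoc, ← ENNReal.ofReal_mul (abs_nonneg _), ← abs_mul,
    mul_inv_cancel₀ hW, abs_one, ENNReal.ofReal_one, one_mul]

variable (Q : Measure (ι → ℝ)) [IsGaussian Q]

lemma map_mulVec_eq_pi_gaussianReal {W : Matrix ι ι ℝ} (hW : W * covMat Q * Wᵀ = 1) :
    Q.map (fun x => W *ᵥ x) = Measure.pi fun i => gaussianReal ((W *ᵥ meanVec Q) i) 1 := by
  let X (i : ι) (x : ι → ℝ) : ℝ := W i ⬝ᵥ x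
  have hX : HasGaussianLaw (fun x i => X i x) Q :=
    (IsGaussian.hasGaussianLaw_id (μ := Q)).map_fun W.mulVecLin.toContinuousLinearMap
  have hcov (i j : ι) : cov[X i, X j; Q] = (1 : Matrix ι ι ℝ) i j := by
    rw [← hW]
    exact covariance_dotProduct Q (W i) (W j)
  have hmeas (i : ι) : AEMeasurable (X i) Q := (hX.eval i).aemeasurable
  have hmean (i : ι) : ∫ x, X i x ∂Q = (W *ᵥ meanVec Q) i := by
    simp only [X, dotProduct]
    rw [integral_finsetSum _ fun k _ => ((memLp_two_eval Q k).const_mul _).integrable one_le_two]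
    simp_rw [integral_const_mul]
    rfl
  have hindep : iIndepFun X Q :=
    hX.iIndepFun_of_covariance_eq_zero fun i j hij => by rw [hcov, one_apply_ne hij]
  refine ((iIndepFun_iff_map_fun_eq_pi_map hmeas).1 hindep).trans (congrArg Measure.pi ?_)
  ext1 i
  rw [(hX.eval i).map_eq_gaussianReal, ← covariance_self (hmeas i), hcov, one_apply_eq,
    Real.toNNReal_one, hmean]

theorem rnDeriv_eq_gaussianWeight (hQ : (covMat Q).PosDef) :
    Q.rnDeriv volume =ᵐ[volume] fun x => ENNReal.ofReal (gaussianWeight (Fintype.card ι)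
      (covMat Q).det ((x - meanVec Q) ⬝ᵥ (covMat Q)⁻¹ *ᵥ (x - meanVec Q))) := by
  obtain ⟨W, hWW, hWS, hdet⟩ := exists_transpose_mul_self_eq_inv hQ
  have hW : W.det ≠ 0 := by
    rw [← abs_pos, hdet]
    exact inv_pos.2 (Real.sqrt_pos.2 hQ.det_pos)
  have hmap := map_mulVec_eq_pi_gaussianReal Q hWS
  rw [pi_gaussianReal_eq_withDensity] at hmap
  have hform (x : ι → ℝ) : (x - meanVec Q) ⬝ᵥ (covMat Q)⁻¹ *ᵥ (x - meanVec Q) =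
      ∑ i, ((W *ᵥ x) i - (W *ᵥ meanVec Q) i) ^ 2 := by
    rw [← hWW, ← mulVec_mulVec, dotProduct_mulVec, vecMul_transpose, mulVec_sub]
    exact Finset.sum_congr rfl fun i _ => (sq _).symm
  have hdensity (x : ι → ℝ) : ENNReal.ofReal |W.det| *
      ENNReal.ofReal (∏ i, gaussianPDFReal ((W *ᵥ meanVec Q) i) 1 ((W *ᵥ x) i)) =
      ENNReal.ofReal (gaussianWeight (Fintype.card ι) (covMat Q).det
        ((x - meanVec Q) ⬝ᵥ (covMat Q)⁻¹ *ᵥ (x - meanVec Q))) := by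
    simp_rw [← ENNReal.ofReal_mul (abs_nonneg _), gaussianPDFReal_one,
      prod_gaussianWeight _ _ fun _ => zero_le_one, hdet, hform, gaussianWeight]
    simp [mul_left_comm, mul_assoc]
  have hQ_eq := eq_withDensity_of_map_mulVec hW (by fun_prop) hmap
  simp_rw [hdensity] at hQ_eq
  conv_lhs => rw [hQ_eq]
  refine Measure.rnDeriv_withDensity _ (ENNReal.measurable_ofReal.comp ?_)
  exact (continuous_gaussianWeight.comp (by fun_prop)).measurable

end GaussianDensity

section MarginalDensity

variable {V : Type*}

lemma covMat_map_restrict (P : Measure (V → ℝ)) (A : Finset V) :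
    covMat (P.map (A.restrict (π := fun _ => ℝ))) = block (covMat P) A A :=
  Matrix.ext fun i j => covariance_map_fun (measurable_pi_apply i).aestronglyMeasurable
    (measurable_pi_apply j).aestronglyMeasurable (Finset.measurable_restrict A).aemeasurable

lemma meanVec_map_restrict (P : Measure (V → ℝ)) (A : Finset V) :
    meanVec (P.map (A.restrict (π := fun _ => ℝ))) = A.restrict (meanVec P) :=
  funext fun a => integral_map (Finset.measurable_restrict A).aemeasurable
    (measurable_pi_apply a).aestronglyMeasurable

lemma isGaussian_map_restrict [Finite V] (P : Measure (V → ℝ)) [IsGaussian P] (A : Finset V) :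
    IsGaussian (P.map (A.restrict (π := fun _ => ℝ))) :=
  have := Fintype.ofFinite V
  ((IsGaussian.hasGaussianLaw_id (μ := P)).map_fun
    (ContinuousLinearMap.pi fun a : A => ContinuousLinearMap.proj (R := ℝ) (a : V))).isGaussian_map

variable [Fintype V]

lemma quasiMeasurePreserving_restrict (A : Finset V) :
    Measure.QuasiMeasurePreserving (A.restrict (π := fun _ => ℝ)) volume volume := by
  classical
  have h := volume_preserving_piEquivPiSubtypeProd (fun _ : V => ℝ) (fun i => i ∈ A)
  convert Measure.quasiMeasurePreserving_fst.comp h.quasiMeasurePreserving <;> rfl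

variable [DecidableEq V] {P : Measure (V → ℝ)} [IsGaussian P]

theorem margDensity_eq_gaussianWeight (hP : (covMat P).PosDef) (A : Finset V) :
    margDensity P A =ᵐ[volume] fun x => ENNReal.ofReal
      (gaussianWeight A.card (block (covMat P) A A).det
        (precForm (covMat P) A (x - meanVec P))) := by
  have := isGaussian_map_restrict P A
  have hcov := covMat_map_restrict P A
  have h := rnDeriv_eq_gaussianWeight (P.map (A.restrict (π := fun _ => ℝ)))
    (hcov ▸ posDef_block hP A)
  filter_upwards [(quasiMeasurePreserving_restrict A).ae h] with x hx
  rw [hcov, meanVec_map_restrict, Fintype.card_coe] at hx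
  exact hx

theorem condDensity_eq_gaussianWeight (hP : (covMat P).PosDef) {K A : Finset V}
    (h : Disjoint K A) :
    condDensity P K A =ᵐ[volume] fun x => ENNReal.ofReal
      (gaussianWeight K.card (schur (covMat P) K A).det
        ((fun i : K => resid (covMat P) A i ⬝ᵥ (x - meanVec P)) ⬝ᵥ
          (schur (covMat P) K A)⁻¹ *ᵥ fun i : K => resid (covMat P) A i ⬝ᵥ (x - meanVec P))) := by
  filter_upwards [margDensity_eq_gaussianWeight hP (K ∪ A), margDensity_eq_gaussianWeight hP A]
    with x hKA hA
  have hpos : 0 < gaussianWeight A.card (block (covMat P) A A).det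
      (precForm (covMat P) A (x - meanVec P)) := gaussianWeight_pos (posDef_block hP A).det_pos
  rw [condDensity, hKA, hA, ← ENNReal.ofReal_div_of_pos hpos, precForm_union hP h,
    det_block_union hP h, mul_comm (det _), Finset.card_union_of_disjoint h,
    gaussianWeight_add (posDef_schur hP h).det_pos.le, mul_div_cancel_right₀ _ hpos.ne']

end MarginalDensity

namespace MixedGraph

open Relation

variable {V : Type*} {G : MixedGraph V} {X Y K : Finset V} {i j l : V}

lemma reflTransGen_step_of_reachable (h : G.und.Reachable i j) : ReflTransGen G.Step i j :=
  ReflTransGen.mono (fun _ _ => Or.inr) _ _ ((SimpleGraph.reachable_iff_reflTransGen _ _).1 h)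

variable [Fintype V]

lemma mem_fa : i ∈ G.fa X ↔ ∃ a ∈ X, G.solid i a := by
  simp only [fa, Finset.mem_filter_univ]

lemma mem_mo : i ∈ G.mo X ↔ ∃ a ∈ X, G.dashed i a := by
  simp only [mo, Finset.mem_filter_univ]

lemma mem_pa : i ∈ G.pa X ↔ ∃ a ∈ X, G.Directed i a := by
  simp only [pa, Finset.mem_filter_univ]

lemma notMem_nd : i ∉ G.nd X ↔ ∃ a ∈ X, ∃ c d,
    ReflTransGen G.Step a c ∧ G.Directed c d ∧ ReflTransGen G.Step d i := by
  simp only [nd, Finset.mem_filter_univ, not_not]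

lemma fa_mono (h : X ⊆ Y) : G.fa X ⊆ G.fa Y := fun _ hb => by
  obtain ⟨a, ha, hba⟩ := mem_fa.1 hb
  exact mem_fa.2 ⟨a, h ha, hba⟩

lemma mo_mono (h : X ⊆ Y) : G.mo X ⊆ G.mo Y := fun _ hb => by
  obtain ⟨a, ha, hba⟩ := mem_mo.1 hb
  exact mem_mo.2 ⟨a, h ha, hba⟩

lemma pa_eq_fa_union_mo [DecidableEq V] (G : MixedGraph V) (X : Finset V) :
    G.pa X = G.fa X ∪ G.mo X := by
  ext b
  simp only [mem_pa, Finset.mem_union, mem_fa, mem_mo, Directed, and_or_left, exists_or]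

lemma mem_nd_of_reflTransGen (hj : j ∈ G.nd X) (h : ReflTransGen G.Step i j) : i ∈ G.nd X := by
  by_contra hi
  obtain ⟨a, ha, c, d, hac, hcd, hdi⟩ := notMem_nd.1 hi
  exact notMem_nd.2 ⟨a, ha, c, d, hac, hcd, hdi.trans h⟩ hj

lemma mem_chainComponents : K ∈ G.chainComponents ↔ G.IsChainComponent K := by
  simp only [chainComponents, Finset.mem_filter_univ]

open Classical in
/-- The chain component of the node `i`. -/
noncomputable def comp (G : MixedGraph V) (i : V) : Finset V :=
  Finset.univ.filter fun j => G.und.Reachable i j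

lemma mem_comp : j ∈ G.comp i ↔ G.und.Reachable i j := by
  simp only [comp, Finset.mem_filter_univ]

lemma self_mem_comp (i : V) : i ∈ G.comp i := mem_comp.2 (SimpleGraph.Reachable.refl i)

lemma reflTransGen_of_mem_comp (hi : i ∈ G.comp l) (hj : j ∈ G.comp l) :
    ReflTransGen G.Step i j :=
  reflTransGen_step_of_reachable ((mem_comp.1 hi).symm.trans (mem_comp.1 hj))

lemma isChainComponent_comp (i : V) : G.IsChainComponent (G.comp i) := by
  refine ⟨⟨⟨i, self_mem_comp i⟩, fun a ha b hb => ?_⟩, fun S hS hle b hb => ?_⟩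
  · exact (mem_comp.1 ha).symm.trans (mem_comp.1 hb)
  · exact mem_comp.2 (hS.2 i (hle (self_mem_comp i)) b hb)

lemma IsChainComponent.eq_comp (hK : G.IsChainComponent K) (hi : i ∈ K) : K = G.comp i := by
  have hle : K ⊆ G.comp i := fun j hj => mem_comp.2 (hK.1.2 i hi j hj)
  exact hle.antisymm (hK.2 (isChainComponent_comp i).1 hle)

lemma forall_isChainComponent_iff {p : Finset V → V → Prop} :
    (∀ K, G.IsChainComponent K → ∀ i ∈ K, p K i) ↔ ∀ i, p (G.comp i) i :=
  ⟨fun h i => h _ (isChainComponent_comp i) i (self_mem_comp i),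
    fun h _ hK i hi => (hK.eq_comp hi) ▸ h i⟩

lemma comp_eq_of_mem (h : j ∈ G.comp i) : G.comp j = G.comp i :=
  ((isChainComponent_comp i).eq_comp h).symm

lemma reflTransGen_of_mem_pa_comp (h : j ∈ G.pa (G.comp i)) : ReflTransGen G.Step j i := by
  obtain ⟨a, ha, hja⟩ := mem_pa.1 h
  exact .head (.inl hja) (reflTransGen_of_mem_comp ha (self_mem_comp i))

lemma mem_nd_sdiff_of_mem_pa_comp [DecidableEq V] (hj : j ∈ G.nd (G.comp i))
    (hl : l ∈ G.pa (G.comp j)) : l ∈ G.nd (G.comp i) \ G.comp i := by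
  refine Finset.mem_sdiff.2
    ⟨mem_nd_of_reflTransGen hj (reflTransGen_of_mem_pa_comp hl), fun hli => ?_⟩
  obtain ⟨a, ha, hla⟩ := mem_pa.1 hl
  exact notMem_nd.2
    ⟨l, hli, l, a, .refl, hla, reflTransGen_of_mem_comp ha (self_mem_comp j)⟩ hj

namespace IsChainGraph

lemma disjoint_pa (hG : G.IsChainGraph) (hK : G.IsChainComponent K) : Disjoint K (G.pa K) := by
  refine Finset.disjoint_left.2 fun b hb hb' => ?_
  obtain ⟨a, ha, hba⟩ := mem_pa.1 hb'
  exact hG b a hba (reflTransGen_step_of_reachable (hK.1.2 a ha b hb))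

lemma comp_subset_nd (hG : G.IsChainGraph) (i : V) : G.comp i ⊆ G.nd (G.comp i) := by
  intro b hb
  by_contra h
  obtain ⟨a, ha, c, d, hac, hcd, hdb⟩ := notMem_nd.1 h
  exact hG c d hcd (hdb.trans ((reflTransGen_of_mem_comp hb ha).trans hac))

lemma pa_subset_nd_sdiff [DecidableEq V] (hG : G.IsChainGraph) (hK : G.IsChainComponent K) :
    G.pa K ⊆ G.nd K \ K := by
  obtain ⟨i, hi⟩ := hK.1.1
  rw [hK.eq_comp hi]
  exact fun l => mem_nd_sdiff_of_mem_pa_comp (hG.comp_subset_nd i (self_mem_comp i))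

lemma mem_nd_or_mem_nd (hG : G.IsChainGraph) (i j : V) :
    j ∈ G.nd (G.comp i) ∨ i ∈ G.nd (G.comp j) := by
  by_contra! h
  obtain ⟨a, ha, c, d, hac, hcd, hdj⟩ := notMem_nd.1 h.1
  obtain ⟨b, hb, c', d', hbc', hcd', hdi'⟩ := notMem_nd.1 h.2
  have hja : ReflTransGen G.Step j a :=
    (reflTransGen_of_mem_comp (self_mem_comp j) hb).trans <| hbc'.trans <| .head (.inl hcd') <|
      hdi'.trans (reflTransGen_of_mem_comp (self_mem_comp i) ha)
  exact hG c d hcd (hdj.trans (hja.trans hac))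

end IsChainGraph

open Classical in
/-- The number of ancestors of `i`, which in a chain graph is larger than that of any parent of the
chain component of `i`. -/
noncomputable def rank (G : MixedGraph V) (i : V) : ℕ :=
  (Finset.univ.filter fun j => ReflTransGen G.Step j i).card

lemma IsChainGraph.rank_lt (hG : G.IsChainGraph) (h : j ∈ G.pa (G.comp i)) :
    G.rank j < G.rank i := by
  classical
  refine Finset.card_lt_card ((Finset.ssubset_iff_of_subset fun k hk => ?_).2 ⟨i, ?_, ?_⟩)
  · simp only [Finset.mem_filter_univ] at hk ⊢
    exact hk.trans (reflTransGen_of_mem_pa_comp h)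
  · simp only [Finset.mem_filter_univ, ReflTransGen.refl]
  · simp only [Finset.mem_filter_univ]
    intro hij
    obtain ⟨a, ha, hja⟩ := mem_pa.1 h
    exact hG j a hja ((reflTransGen_of_mem_comp ha (self_mem_comp i)).trans hij)

/-- The partition of the nodes into chain components. -/
noncomputable def sigmaComponents (G : MixedGraph V) :
    (Σ K : G.chainComponents, (K : Finset V)) ≃ V :=
  Equiv.ofBijective (fun p => (p.2 : V)) <| by
    constructor
    · rintro ⟨⟨K, hK⟩, ⟨i, hi⟩⟩ ⟨⟨L, hL⟩, ⟨j, hj⟩⟩ h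
      obtain rfl : i = j := h
      obtain rfl : K = L :=
        ((mem_chainComponents.1 hK).eq_comp hi).trans ((mem_chainComponents.1 hL).eq_comp hj).symm
      rfl
    · exact fun i => ⟨⟨⟨G.comp i, mem_chainComponents.2 (isChainComponent_comp i)⟩,
        ⟨i, self_mem_comp i⟩⟩, rfl⟩

lemma comp_sigmaComponents (p : Σ K : G.chainComponents, (K : Finset V)) :
    G.comp (G.sigmaComponents p) = p.1 :=
  ((mem_chainComponents.1 p.1.2).eq_comp p.2.2).symm

lemma card_eq_sum_card_chainComponents (G : MixedGraph V) :
    Fintype.card V = ∑ K : G.chainComponents, (K : Finset V).card := by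
  simp only [← Fintype.card_congr G.sigmaComponents, Fintype.card_sigma, Fintype.card_coe]

end MixedGraph

section Factorization

variable {V : Type*} [Fintype V] [DecidableEq V] {G : MixedGraph V} {S : Matrix V V ℝ}

/-- The parents of the chain component of the node `i`. -/
noncomputable abbrev MixedGraph.compPa (G : MixedGraph V) (i : V) : Finset V :=
  G.pa (G.comp i)

lemma det_residMat_compPa (hG : G.IsChainGraph) : (residMat S G.compPa).det = 1 :=
  det_residMat fun _ _ => hG.rank_lt

lemma residCov_compPa_apply (hS : S.PosDef) (K : G.chainComponents) (i j : (K : Finset V)) :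
    residCov S G.compPa i j = schur S K (G.pa K) i j := by
  have hcomp (k : (K : Finset V)) : G.comp k = K := G.comp_sigmaComponents ⟨K, k⟩
  rw [residCov_apply_of_uncorr fun l hl => ?_, schur_apply, MixedGraph.compPa, hcomp]
  rw [MixedGraph.compPa, hcomp, ← hcomp i] at hl
  exact resid_vecMul_apply_of_mem hS i hl

lemma residCov_eq_blockDiagonal'_iff (hS : S.PosDef) :
    (residCov S G.compPa).submatrix G.sigmaComponents G.sigmaComponents =
        blockDiagonal' (fun K : G.chainComponents => schur S K (G.pa K)) ↔
      ∀ i j, j ∉ G.comp i → residCov S G.compPa i j = 0 := by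
  constructor
  · intro h i j hj
    obtain ⟨p, rfl⟩ := G.sigmaComponents.surjective i
    obtain ⟨q, rfl⟩ := G.sigmaComponents.surjective j
    rw [← submatrix_apply (residCov S G.compPa), h, blockDiagonal'_apply, dif_neg]
    intro hpq
    rw [G.comp_sigmaComponents, hpq] at hj
    exact hj q.2.2
  · intro h
    ext ⟨K, i⟩ ⟨L, j⟩
    obtain rfl | hKL := eq_or_ne K L
    · rw [blockDiagonal'_apply_eq]
      exact residCov_compPa_apply hS K i j
    · rw [blockDiagonal'_apply_ne _ _ _ hKL]
      refine h _ _ fun hj => hKL (Subtype.ext ?_)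
      rw [G.comp_sigmaComponents ⟨K, i⟩] at hj
      exact ((MixedGraph.mem_chainComponents.1 K.2).eq_comp hj).trans
        (G.comp_sigmaComponents ⟨L, j⟩)

lemma residUncorr_nd_iff_residCov_eq_zero (hS : S.PosDef) (hG : G.IsChainGraph) :
    (∀ i, ResidUncorr S (G.compPa i) i (G.nd (G.comp i) \ G.comp i)) ↔
      ∀ i j, j ∉ G.comp i → residCov S G.compPa i j = 0 := by
  have hiff (i : V) := residUncorr_iff_residCov (S := S) (π := G.compPa)
    (fun _ _ => hG.rank_lt) i (N := G.nd (G.comp i) \ G.comp i) fun _ hj _ =>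
      MixedGraph.mem_nd_sdiff_of_mem_pa_comp (Finset.mem_sdiff.1 hj).1
  simp only [hiff, Finset.mem_sdiff]
  refine ⟨fun h i j hj => ?_, fun h i j hj => h i j hj.2⟩
  obtain hnd | hnd := hG.mem_nd_or_mem_nd i j
  · exact h i j ⟨hnd, hj⟩
  · rw [← (isSymm_of_posDef (posDef_residCov hS (det_residMat_compPa hG))).apply]
    refine h j i ⟨hnd, fun hi => hj ?_⟩
    rw [MixedGraph.comp_eq_of_mem hi]
    exact MixedGraph.self_mem_comp j

/-- The sum over the chain components `K` of `G` of the quadratic forms of the precision matrices of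
`K` given its parents, evaluated at the residuals of `y`. -/
noncomputable def compForm (G : MixedGraph V) (S : Matrix V V ℝ) (y : V → ℝ) : ℝ :=
  ∑ K : G.chainComponents, (fun i : (K : Finset V) => resid S (G.pa K) i ⬝ᵥ y) ⬝ᵥ
    (schur S K (G.pa K))⁻¹ *ᵥ fun i : (K : Finset V) => resid S (G.pa K) i ⬝ᵥ y

lemma compForm_zero : compForm G S 0 = 0 := by
  simp only [compForm, dotProduct_zero, ← Pi.zero_def, zero_dotProduct, Finset.sum_const_zero]

lemma continuous_compForm : Continuous (compForm G S) := by
  unfold compForm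
  fun_prop

lemma posDef_schur_pa (hS : S.PosDef) (hG : G.IsChainGraph) (K : G.chainComponents) :
    (schur S K (G.pa K)).PosDef :=
  posDef_schur hS (hG.disjoint_pa (MixedGraph.mem_chainComponents.1 K.2))

lemma compForm_eq_blockDiagonal' (hS : S.PosDef) (hG : G.IsChainGraph) (y : V → ℝ) :
    compForm G S y = ((residMat S G.compPa *ᵥ y) ∘ G.sigmaComponents) ⬝ᵥ
      (blockDiagonal' fun K : G.chainComponents => schur S K (G.pa K))⁻¹ *ᵥ
        ((residMat S G.compPa *ᵥ y) ∘ G.sigmaComponents) := by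
  rw [inv_blockDiagonal' fun K => (posDef_schur_pa hS hG K).det_pos.ne'.isUnit,
    dotProduct_blockDiagonal'_mulVec]
  refine Finset.sum_congr rfl fun K _ => ?_
  have hresid : (fun i : (K : Finset V) => resid S (G.pa K) i ⬝ᵥ y) =
      fun i => ((residMat S G.compPa *ᵥ y) ∘ G.sigmaComponents) ⟨K, i⟩ :=
    funext fun i => congrArg (fun A => resid S (G.pa A) i ⬝ᵥ y) (G.comp_sigmaComponents ⟨K, i⟩).symm
  rw [hresid]

lemma forall_eq_compForm_iff (hS : S.PosDef) (hG : G.IsChainGraph) :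
    (∀ y, y ⬝ᵥ S⁻¹ *ᵥ y = compForm G S y) ↔
      (residCov S G.compPa).submatrix G.sigmaComponents G.sigmaComponents =
        blockDiagonal' (fun K : G.chainComponents => schur S K (G.pa K)) := by
  set e := G.sigmaComponents
  have hR := det_residMat_compPa (S := S) hG
  have hD : ((residCov S G.compPa).submatrix e e).PosDef :=
    (posDef_residCov hS hR).submatrix e.injective
  have hB : (blockDiagonal' fun K : G.chainComponents => schur S K (G.pa K)).IsSymm := by
    rw [IsSymm, blockDiagonal'_transpose]
    exact congrArg _ (funext fun K => isSymm_of_posDef (posDef_schur_pa hS hG K))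
  have hform (y : V → ℝ) : y ⬝ᵥ S⁻¹ *ᵥ y = ((residMat S G.compPa *ᵥ y) ∘ e) ⬝ᵥ
      ((residCov S G.compPa).submatrix e e)⁻¹ *ᵥ ((residMat S G.compPa *ᵥ y) ∘ e) := by
    rw [dotProduct_inv_mulVec_eq_residCov hR, inv_submatrix_equiv, submatrix_mulVec_equiv,
      Function.comp_assoc, e.self_comp_symm, Function.comp_id, comp_equiv_dotProduct_comp_equiv]
  have hsurj : Function.Surjective fun y => (residMat S G.compPa *ᵥ y) ∘ e :=
    e.injective.surjective_comp_right.comp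
      (mulVec_surjective_iff_isUnit.2 ((isUnit_iff_isUnit_det _).2 (hR ▸ isUnit_one)))
  simp only [hform, compForm_eq_blockDiagonal' hS hG]
  rw [← hsurj.forall (p := fun u => u ⬝ᵥ ((residCov S G.compPa).submatrix e e)⁻¹ *ᵥ u =
    u ⬝ᵥ (blockDiagonal' fun K : G.chainComponents => schur S K (G.pa K))⁻¹ *ᵥ u)]
  refine ⟨fun h => ?_, fun h u => by rw [h]⟩
  refine Matrix.inv_inj (eq_of_dotProduct_mulVec_self_eq (isSymm_of_posDef hD.inv) ?_ h)
    hD.det_pos.ne'.isUnit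
  rw [IsSymm, transpose_nonsing_inv, hB.eq]

lemma det_eq_prod_det_schur (hG : G.IsChainGraph)
    (h : (residCov S G.compPa).submatrix G.sigmaComponents G.sigmaComponents =
      blockDiagonal' (fun K : G.chainComponents => schur S K (G.pa K))) :
    S.det = ∏ K : G.chainComponents, (schur S K (G.pa K)).det := by
  rw [← det_blockDiagonal', ← h, det_submatrix_equiv_self, det_residCov (det_residMat_compPa hG)]

variable {P : Measure (V → ℝ)} [IsGaussian P]

lemma prod_condDensity_eq_gaussianWeight (hP : (covMat P).PosDef) (hG : G.IsChainGraph) :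
    (fun x => ∏ K ∈ G.chainComponents, condDensity P K (G.pa K) x) =ᵐ[volume] fun x =>
      ENNReal.ofReal (gaussianWeight (Fintype.card V)
        (∏ K : G.chainComponents, (schur (covMat P) K (G.pa K)).det)
        (compForm G (covMat P) (x - meanVec P))) := by
  have hpos (K : G.chainComponents) := (posDef_schur_pa hP hG K).det_pos
  have hcond (K : G.chainComponents) :=
    condDensity_eq_gaussianWeight hP (hG.disjoint_pa (MixedGraph.mem_chainComponents.1 K.2))
  filter_upwards [ae_all_iff.2 hcond] with x hx
  rw [← Finset.prod_coe_sort, Finset.prod_congr rfl fun K _ => hx K,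
    ← ENNReal.ofReal_prod_of_nonneg fun K _ => (gaussianWeight_pos (hpos K)).le,
    prod_gaussianWeight _ _ fun K => (hpos K).le, ← G.card_eq_sum_card_chainComponents]
  rfl

lemma factorizes_iff_forall_gaussianWeight_eq (hP : (covMat P).PosDef) (hG : G.IsChainGraph) :
    Factorizes G P ↔ ∀ y : V → ℝ,
      gaussianWeight (Fintype.card V) (covMat P).det (y ⬝ᵥ (covMat P)⁻¹ *ᵥ y) =
        gaussianWeight (Fintype.card V)
          (∏ K : G.chainComponents, (schur (covMat P) K (G.pa K)).det)
          (compForm G (covMat P) y) := by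
  set f : (V → ℝ) → ℝ := fun y =>
    gaussianWeight (Fintype.card V) (covMat P).det (y ⬝ᵥ (covMat P)⁻¹ *ᵥ y)
  set g : (V → ℝ) → ℝ := fun y => gaussianWeight (Fintype.card V)
    (∏ K : G.chainComponents, (schur (covMat P) K (G.pa K)).det) (compForm G (covMat P) y)
  have hfcont : Continuous f := continuous_gaussianWeight.comp (by fun_prop)
  have hgcont : Continuous g := continuous_gaussianWeight.comp continuous_compForm
  have hfpos (y) : 0 ≤ f y := (gaussianWeight_pos hP.det_pos).le
  have hgpos (y) : 0 ≤ g y :=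
    (gaussianWeight_pos (Finset.prod_pos fun K _ => (posDef_schur_pa hP hG K).det_pos)).le
  calc Factorizes G P
    _ ↔ (fun x => f (x - meanVec P)) =ᵐ[volume] fun x => g (x - meanVec P) := by
      refine Filter.eventually_congr ?_
      filter_upwards [rnDeriv_eq_gaussianWeight P hP, prod_condDensity_eq_gaussianWeight hP hG]
        with x hx hx'
      rw [hx, hx', ENNReal.ofReal_eq_ofReal_iff (hfpos _) (hgpos _)]
    _ ↔ (fun x => f (x - meanVec P)) = fun x => g (x - meanVec P) :=
      Continuous.ae_eq_iff_eq volume (by fun_prop) (by fun_prop)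
    _ ↔ ∀ x, f (x - meanVec P) = g (x - meanVec P) := funext_iff
    _ ↔ ∀ y, f y = g y := (Equiv.subRight (meanVec P)).forall_congr_right (q := fun y => f y = g y)

theorem factorizes_iff (hP : (covMat P).PosDef) (hG : G.IsChainGraph) :
    Factorizes G P ↔ ∀ K, G.IsChainComponent K → ∀ i ∈ K,
      ResidUncorr (covMat P) (G.pa K) i (G.nd K \ K) := by
  have hdet : 0 < ∏ K : G.chainComponents, (schur (covMat P) K (G.pa K)).det :=
    Finset.prod_pos fun K _ => (posDef_schur_pa hP hG K).det_pos
  rw [factorizes_iff_forall_gaussianWeight_eq hP hG,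
    forall_gaussianWeight_eq_iff (y₀ := 0) (by rw [zero_dotProduct, compForm_zero]) hP.det_pos hdet,
    forall_eq_compForm_iff hP hG, and_iff_right_of_imp (det_eq_prod_det_schur hG),
    residCov_eq_blockDiagonal'_iff hP, ← residUncorr_nd_iff_residCov_eq_zero hP hG,
    MixedGraph.forall_isChainComponent_iff]

end Factorization

section BlockRecursive

variable {V : Type*} [DecidableEq V] {G : MixedGraph V} {S : Matrix V V ℝ}
  {P : Measure (V → ℝ)} {K A : Finset V} {i : V}

lemma regCoef_apply_eq_zero_iff (h : Disjoint K A) (i : K) (j : A) :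
    regCoef P K A i j = 0 ↔ resid (covMat P) A i j = 0 := by
  rw [resid_apply_coe (Finset.disjoint_left.1 h i.2), neg_eq_zero]
  rfl

lemma inv_condCov_apply_eq_zero_iff [Finite V] (hP : (covMat P).PosDef) (h : Disjoint K A)
    (i j : K) :
    (condCov P K A)⁻¹ i j = 0 ↔ resid (covMat P) ((K ∪ A) \ {(i : V)}) i j = 0 := by
  rw [← inv_block_apply_eq_zero_iff hP ⟨i, Finset.mem_union_left A i.2⟩
    ⟨j, Finset.mem_union_left A j.2⟩, inv_block_union_apply hP h]
  rfl

variable [Fintype V]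

/-- The zero restrictions of the missing edges of `G` at a node `i` of the chain component `K`, all
of them in terms of regressions: of `i` on the parents of `K` for the missing edges from mothers,
and of `i` on the parents and on the rest of `K` for the other missing edges. -/
structure RegressionZeros (G : MixedGraph V) (S : Matrix V V ℝ) (K : Finset V) (i : V) : Prop where
  mothers : ∀ j ∈ G.mo K \ G.mo {i}, resid S (G.pa K) i j = 0
  fathers : ∀ j ∈ G.fa K \ G.fa {i}, resid S ((K ∪ G.pa K) \ {i}) i j = 0
  neighbors : ∀ j ∈ (K \ {i}) \ G.ne {i}, resid S ((K ∪ G.pa K) \ {i}) i j = 0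

theorem zeroRestrictions_iff (hP : (covMat P).PosDef) (hG : G.IsChainGraph) :
    ZeroRestrictions G P ↔
      ∀ K, G.IsChainComponent K → ∀ i ∈ K, RegressionZeros G (covMat P) K i := by
  have hmo {K : Finset V} {j : V} {X : Finset V} (hj : j ∈ G.mo K \ X) : j ∈ G.pa K :=
    G.pa_eq_fa_union_mo K ▸ Finset.mem_union_right _ (Finset.mem_sdiff.1 hj).1
  have hfa {K : Finset V} {j : V} {X : Finset V} (hj : j ∈ G.fa K \ X) : j ∈ G.pa K :=
    G.pa_eq_fa_union_mo K ▸ Finset.mem_union_left _ (Finset.mem_sdiff.1 hj).1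
  constructor
  · rintro ⟨hmothers, hfathers, hneighbors⟩ K hK i hi
    have hdisj := hG.disjoint_pa hK
    refine ⟨fun j hj => ?_, fun j hj => ?_, fun j hj => ?_⟩
    · exact (regCoef_apply_eq_zero_iff hdisj ⟨i, hi⟩ ⟨j, hmo hj⟩).1 (hmothers K hK _ _ hj)
    · exact (inv_block_apply_eq_zero_iff hP ⟨i, Finset.mem_union_left _ hi⟩
        ⟨j, Finset.mem_union_right _ (hfa hj)⟩).1 (hfathers K hK _ _ hi hj)
    · exact (inv_condCov_apply_eq_zero_iff hP hdisj ⟨i, hi⟩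
        ⟨j, (Finset.mem_sdiff.1 (Finset.mem_sdiff.1 hj).1).1⟩).1 (hneighbors K hK _ _ hj)
  · intro h
    refine ⟨fun K hK i j hj => ?_, fun K hK i j hi hj => ?_, fun K hK i j hj => ?_⟩
    · exact (regCoef_apply_eq_zero_iff (hG.disjoint_pa hK) i j).2 ((h K hK i i.2).mothers j hj)
    · exact (inv_block_apply_eq_zero_iff hP i j).2 ((h K hK i hi).fathers j hj)
    · exact (inv_condCov_apply_eq_zero_iff hP (hG.disjoint_pa hK) i j).2
        ((h K hK i i.2).neighbors j hj)

lemma residUncorr_mothers_iff (hS : S.PosDef) (hG : G.IsUCG) (hK : G.IsChainComponent K)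
    (hi : i ∈ K) :
    ResidUncorr S (G.fa K ∪ G.mo {i}) i (((G.nd K \ K) \ G.fa K) \ G.mo {i}) ↔
      (∀ j ∈ G.mo K \ G.mo {i}, resid S (G.pa K) i j = 0) ∧
        ResidUncorr S (G.pa K) i (G.nd K \ K) := by
  have hmo : G.mo {i} ⊆ G.mo K := MixedGraph.mo_mono (Finset.singleton_subset_iff.2 hi)
  have hfamo := Finset.disjoint_left.1 (hG.disjoint_fa_mo K hK)
  have hiA := Finset.disjoint_left.1 (hG.isChainGraph.disjoint_pa hK) hi
  have hpa := hG.isChainGraph.pa_subset_nd_sdiff hK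
  rw [G.pa_eq_fa_union_mo] at hiA hpa ⊢
  have hnew : (G.fa K ∪ G.mo K) \ (G.fa K ∪ G.mo {i}) = G.mo K \ G.mo {i} := by grind
  rw [residUncorr_iff_of_subset hS (Finset.union_subset_union_right hmo) hiA (B' := G.nd K \ K)
    (by grind) (by grind) (by grind), hnew]

lemma residUncorr_fathers_iff (hS : S.PosDef) (hG : G.IsUCG) (hK : G.IsChainComponent K)
    (hi : i ∈ K) :
    ResidUncorr S ((K \ {i}) ∪ G.fa {i} ∪ G.mo K) i (((G.nd K \ K) \ G.fa {i}) \ G.mo K) ↔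
      (∀ j ∈ G.fa K \ G.fa {i}, resid S ((K ∪ G.pa K) \ {i}) i j = 0) ∧
        ResidUncorr S ((K ∪ G.pa K) \ {i}) i (G.nd K \ K) := by
  have hfa : G.fa {i} ⊆ G.fa K := MixedGraph.fa_mono (Finset.singleton_subset_iff.2 hi)
  have hfamo := Finset.disjoint_left.1 (hG.disjoint_fa_mo K hK)
  have hKpa := Finset.disjoint_left.1 (hG.isChainGraph.disjoint_pa hK)
  have hpa := hG.isChainGraph.pa_subset_nd_sdiff hK
  rw [G.pa_eq_fa_union_mo] at hKpa hpa ⊢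
  have hnew : ((K ∪ (G.fa K ∪ G.mo K)) \ {i}) \ ((K \ {i}) ∪ G.fa {i} ∪ G.mo K) =
      G.fa K \ G.fa {i} := by grind
  rw [residUncorr_iff_of_subset hS (C' := (K ∪ (G.fa K ∪ G.mo K)) \ {i}) (B' := G.nd K \ K)
    (by grind) (by grind) (by grind) (by grind) (by grind), hnew]

lemma residUncorr_neighbor_iff (hS : S.PosDef) (h : Disjoint K A) (hi : i ∈ K)
    {j : V} (hj : j ∈ K \ {i}) :
    ResidUncorr S ((K \ {i, j}) ∪ A) i {j} ↔ resid S ((K ∪ A) \ {i}) i j = 0 := by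
  have hKA := Finset.disjoint_left.1 h
  have hnew : ((K ∪ A) \ {i}) \ ((K \ {i, j}) ∪ A) = {j} := by grind
  rw [residUncorr_iff_of_subset hS (C' := (K ∪ A) \ {i}) (B' := ∅)
    (by grind) (by grind) (by grind) (by grind) (by grind), hnew]
  simp only [Finset.mem_singleton, forall_eq]
  exact and_iff_left fun _ hk => absurd hk (Finset.notMem_empty _)

theorem blockRecursiveMarkov_iff [IsGaussian P] (hP : (covMat P).PosDef)
    (hG : G.IsUCG) :
    BlockRecursiveMarkov G P ↔ ∀ K, G.IsChainComponent K → ∀ i ∈ K,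
      ResidUncorr (covMat P) (G.pa K) i (G.nd K \ K) ∧ RegressionZeros G (covMat P) K i := by
  have hcondIndep (i : V) (B C : Finset V) :
      CondIndepGiven P {i} B C ↔ ResidUncorr (covMat P) C i B := by
    simp only [condIndepGiven_iff hP, Finset.mem_singleton, forall_eq]
  have hneighbor {K : Finset V} (hK : G.IsChainComponent K) {i j : V} (hi : i ∈ K)
      (hj : j ∈ (K \ {i}) \ G.ne {i}) := residUncorr_neighbor_iff hP
    (hG.isChainGraph.disjoint_pa hK) hi (Finset.mem_sdiff.1 hj).1
  constructor
  · rintro ⟨hb1, hb2, hb3⟩ K hK i hi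
    simp only [hcondIndep] at hb1 hb2 hb3
    obtain ⟨hmothers, huncorr⟩ := (residUncorr_mothers_iff hP hG hK hi).1 (hb1 K hK i hi)
    obtain ⟨hfathers, -⟩ := (residUncorr_fathers_iff hP hG hK hi).1 (hb2 K hK i hi)
    exact ⟨huncorr, hmothers, hfathers,
      fun j hj => (hneighbor hK hi hj).1 (hb3 K hK i hi j hj)⟩
  · intro h
    constructor <;> simp only [hcondIndep]
    · intro K hK i hi
      obtain ⟨huncorr, hzeros⟩ := h K hK i hi
      exact (residUncorr_mothers_iff hP hG hK hi).2 ⟨hzeros.mothers, huncorr⟩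
    · intro K hK i hi
      have huncorr := ResidUncorr.union_sdiff_singleton hP (fun k hk => (h K hK k hk).1) hi
        (Finset.disjoint_left.1 (hG.isChainGraph.disjoint_pa hK) hi)
      exact (residUncorr_fathers_iff hP hG hK hi).2 ⟨(h K hK i hi).2.fathers, huncorr⟩
    · exact fun K hK i hi j hj => (hneighbor hK hi hj).2 ((h K hK i hi).2.neighbors j hj)

end BlockRecursive

theorem mainTheorem3 {V : Type*} [Fintype V] [DecidableEq V] (G : MixedGraph V) (hG : G.IsUCG)
    (P : Measure (V → ℝ)) [IsGaussian P] (hP : (covMat P).PosDef) :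
    (Factorizes G P ∧ ZeroRestrictions G P) ↔ BlockRecursiveMarkov G P := by
  rw [factorizes_iff hP hG.isChainGraph, zeroRestrictions_iff hP hG.isChainGraph,
    blockRecursiveMarkov_iff hP hG]
  simp only [forall_and]
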